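/- Let $n\ge 1$ and $\lambda\in[1/4,1)$. The 2-choice process with $n$ bins and $n$ generators evolves in rounds. At the start of a round every non-empty bin deletes one ball. Then each generator, independently of everything else, generates a ball with probability $\lambda$, and every generated ball draws two bins independently and uniformly at random (with replacement) and is placed into a least loaded one of the two. All balls of a round are placed in parallel, according to the loads right after the deletions; ties are resolved by the ordering of the bins by load (the bin with the larger index $i$ in a non-increasing ordering of the loads is taken), so that each ball falls into the $i$-th fullest bin with probability $(2i-1)/n^2$. The load vector $\boldsymbol X(t)=(X_1(t)\ge X_2(t)\ge\dots\ge X_n(t))\in\mathbb N^n$ lists the loads after round $t$ in non-increasing order. It is a time-homogeneous Markov chain $\boldsymbol X$ on the non-increasing vectors in $\mathbb N^n$. Call a state positive recurrent if the chain started in it returns to it with probability $1$ and the expected return time is finite. Then every state $x$ that is reachable from the empty system $(0,\dots,0)$ is positive recurrent, and the chain has a unique stationary distribution (unique among all probability distributions on the set of non-increasing vectors in $\mathbb N^n$). If $n\ge2$, the chain is moreover irreducible: every non-increasing vector in $\mathbb N^n$ is reachable from every other one, so that every state is positive recurrent. -/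

import Mathlib

/-!
In one round the deletions lower the sum of the squared loads by about twice the total load, and
the arrivals raise it in expectation by at most about `λ` times as much, since the less loaded of
two bins has at most their average load. So this sum has negative drift once the total load is
large, and by Foster's criterion the chain enters a finite set of states in finite expected time.
As `λ < 1`, a round without arrivals has positive probability, so the empty system is reachable
from everywhere, and is hence reached in finite expected time as well; the same then holds for
every state that is reachable from it.

The expected numbers of visits during an excursion from the empty system `o` form a finite
invariant measure `ν` with `ν o = 1`. An invariant measure `p` dominates `p o • ν`, and the
difference is invariant and vanishes at `o`, hence everywhere, since `o` is reachable from
everywhere.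

If `n ≥ 2`, the generators can keep all bins but one unchanged while a ball is added to that bin
or moved to it from bin `0`. So every configuration can be built by first piling up all balls in
bin `0` and then moving them one by one.
-/

namespace TwoChoice

/-- Load vectors of `n` bins: `x i` is the load of the `(i+1)`-st fullest bin, so the
entries are listed in non-increasing order. -/
abbrev LoadVector (n : ℕ) : Type := {x : Fin n → ℕ // Antitone x}

/-- The load vector of the empty system. -/
def emptySystem (n : ℕ) : LoadVector n := ⟨fun _ => 0, fun _ _ _ => le_rfl⟩

/-- The load vector of a configuration: its loads, sorted in non-increasing order. -/
def toLoadVector {n : ℕ} (z : Fin n → ℕ) : LoadVector n :=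
  ⟨fun i => z (Tuple.sort z (Fin.rev i)),
    fun _ _ h => Tuple.monotone_sort z (Fin.rev_le_rev.mpr h)⟩

/-- The random choices of one round: for each of the `n` generators, whether it generates a
ball, and the two bins that this ball queries (irrelevant if there is no ball). -/
abbrev Round (n : ℕ) : Type := Fin n → Bool × Fin n × Fin n

/-- A least loaded one of the bins `i` and `j` in the configuration `y`. Bins are numbered from
the fullest to the emptiest, and ties are broken in favour of the larger number. -/
def leastLoaded {n : ℕ} (y : Fin n → ℕ) (i j : Fin n) : Fin n :=
  if y i < y j then i else if y j < y i then j else max i j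

/-- The loads after the deletions at the start of a round: each non-empty bin loses one ball. -/
def afterDeletion {n : ℕ} (x : LoadVector n) : Fin n → ℕ := fun i => x.1 i - 1

/-- One round of the 2-choice process. All balls of the round are allocated in parallel,
according to the loads after the deletions. -/
def step {n : ℕ} (x : LoadVector n) (r : Round n) : LoadVector n :=
  toLoadVector fun i => afterDeletion x i +
    (Finset.univ.filter fun g : Fin n =>
      (r g).1 = true ∧ leastLoaded (afterDeletion x) (r g).2.1 (r g).2.2 = i).card

/-- The process started in `x`, driven by the choices `ω 0, ω 1, …` of the successive rounds:
`process x ω t` is the load vector after `t` rounds. -/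
def process {n : ℕ} (x : LoadVector n) (ω : ℕ → Round n) : ℕ → LoadVector n
  | 0 => x
  | t + 1 => step (process x ω t) (ω t)

/-- The law of one generator's choices: a ball is generated with probability `lam`, and,
independently, two bins are drawn independently and uniformly at random. -/
noncomputable def generatorLaw (n : ℕ) [NeZero n] (lam : unitInterval) :
    MeasureTheory.Measure (Bool × Fin n × Fin n) :=
  (ProbabilityTheory.bernoulliMeasure true false lam).prod
    ((PMF.uniformOfFintype (Fin n)).toMeasure.prod (PMF.uniformOfFintype (Fin n)).toMeasure)

/-- The law of the choices of one round; the generators are independent. -/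
noncomputable def roundLaw (n : ℕ) [NeZero n] (lam : unitInterval) :
    MeasureTheory.Measure (Round n) :=
  MeasureTheory.Measure.pi fun _ : Fin n => generatorLaw n lam

/-- The law of the choices of all rounds; the rounds are independent. -/
noncomputable def choicesLaw (n : ℕ) [NeZero n] (lam : unitInterval) :
    MeasureTheory.Measure (ℕ → Round n) :=
  MeasureTheory.Measure.infinitePi fun _ : ℕ => roundLaw n lam

/-- The transition probabilities of the Markov chain of load vectors. -/
noncomputable def transProb {n : ℕ} [NeZero n] (lam : unitInterval) (x y : LoadVector n) :
    ENNReal :=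
  roundLaw n lam {r | step x r = y}

/-- `y` is reachable from `x` by finitely many transitions of positive probability. -/
def Reachable {n : ℕ} [NeZero n] (lam : unitInterval) (x y : LoadVector n) : Prop :=
  Relation.ReflTransGen (fun u v : LoadVector n => 0 < transProb lam u v) x y

/-- The first time `t ≥ 1` at which the process started in `x` is back in `x`
(`⊤` if it never returns). -/
noncomputable def returnTime {n : ℕ} (x : LoadVector n) (ω : ℕ → Round n) : ℕ∞ :=
  ⨅ (t : ℕ) (_ : 1 ≤ t ∧ process x ω t = x), (t : ℕ∞)

/-- The state `x` is positive recurrent: the chain started in `x` returns to `x` with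
probability one, and the expected return time is finite. -/
def PositiveRecurrent {n : ℕ} [NeZero n] (lam : unitInterval) (x : LoadVector n) : Prop :=
  choicesLaw n lam {ω | returnTime x ω < ⊤} = 1 ∧
    ∫⁻ ω, (returnTime x ω : ENNReal) ∂(choicesLaw n lam) < ⊤

/-- `p` is a stationary distribution of the Markov chain of load vectors. -/
def Stationary {n : ℕ} [NeZero n] (lam : unitInterval) (p : PMF (LoadVector n)) : Prop :=
  ∀ y, ∑' x, p x * transProb lam x y = p y

end TwoChoice

namespace DiscreteChain

open Function Relation
open scoped ENNReal

variable {S : Type*}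

section Potential

variable (Q : S → S → ℝ≥0∞)

/-- The action `f ↦ Q f` of a non-negative, possibly infinite matrix on column vectors. Its action
`p ↦ p Q` on row vectors, that is, on measures, is `mulVec (swap Q)`. -/
noncomputable def mulVec : Module.End ℝ≥0∞ (S → ℝ≥0∞) where
  toFun f x := ∑' y, Q x y * f y
  map_add' f g := by ext x; simp only [Pi.add_apply, mul_add, ENNReal.tsum_add]
  map_smul' c f := by
    ext x
    simp only [Pi.smul_apply, smul_eq_mul, RingHom.id_apply, ← ENNReal.tsum_mul_left]
    exact tsum_congr fun y => mul_left_comm _ _ _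

/-- The potential `∑ₜ Qᵗ f` of `f`, the least non-negative solution `g` of the Poisson equation
`g = f + Q g`. -/
noncomputable def potential (f : S → ℝ≥0∞) (x : S) : ℝ≥0∞ := ∑' t, (mulVec Q ^ t) f x

lemma mulVec_apply (f : S → ℝ≥0∞) (x : S) : mulVec Q f x = ∑' y, Q x y * f y := rfl

lemma mulVec_one (x : S) : mulVec Q 1 x = ∑' y, Q x y := by simp [mulVec_apply]

variable {Q} in
lemma mulVec_mono {Q' : S → S → ℝ≥0∞} {f g : S → ℝ≥0∞} (hQ : Q ≤ Q') (hfg : f ≤ g) :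
    mulVec Q f ≤ mulVec Q' g :=
  fun x => ENNReal.tsum_le_tsum fun y => mul_le_mul' (hQ x y) (hfg y)

lemma mulVec_tsum {ι : Type*} (f : ι → S → ℝ≥0∞) (x : S) :
    mulVec Q (fun y => ∑' i, f i y) x = ∑' i, mulVec Q (f i) x := by
  simp only [mulVec_apply, ← ENNReal.tsum_mul_left]
  exact ENNReal.tsum_comm

lemma tsum_mul_mulVec (p f : S → ℝ≥0∞) :
    ∑' x, p x * mulVec Q f x = ∑' y, mulVec (swap Q) p y * f y := by
  simp only [mulVec_apply, ← ENNReal.tsum_mul_left, ← ENNReal.tsum_mul_right]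
  rw [ENNReal.tsum_comm]
  exact tsum_congr fun y => tsum_congr fun x => by simp only [swap]; ring

lemma tsum_mul_mulVec_pow (p f : S → ℝ≥0∞) (t : ℕ) :
    ∑' x, p x * (mulVec Q ^ t) f x = ∑' y, (mulVec (swap Q) ^ t) p y * f y := by
  induction t generalizing f with
  | zero => simp
  | succ t ih =>
    rw [pow_succ, Module.End.mul_apply, ih, tsum_mul_mulVec, pow_succ', Module.End.mul_apply]

lemma tsum_mul_potential (p f : S → ℝ≥0∞) :
    ∑' x, p x * potential Q f x = ∑' y, potential (swap Q) p y * f y := by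
  simp only [potential, ← ENNReal.tsum_mul_left, ← ENNReal.tsum_mul_right]
  rw [ENNReal.tsum_comm, ENNReal.tsum_comm (β := ℕ)]
  exact tsum_congr fun t => tsum_mul_mulVec_pow Q p f t

lemma potential_eq (f : S → ℝ≥0∞) : potential Q f = f + mulVec Q (potential Q f) := by
  ext x
  have hshift : mulVec Q (potential Q f) x = ∑' t, (mulVec Q ^ (t + 1)) f x := by
    simp only [pow_succ', Module.End.mul_apply]
    exact mulVec_tsum Q _ x
  rw [Pi.add_apply, hshift, potential, tsum_eq_zero_add' ENNReal.summable, pow_zero,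
    Module.End.one_apply]

lemma potential_smul (c : ℝ≥0∞) (f : S → ℝ≥0∞) : potential Q (c • f) = c • potential Q f := by
  ext x
  simp only [potential, map_smul, Pi.smul_apply, smul_eq_mul, ENNReal.tsum_mul_left]

variable {Q} in
lemma potential_le {f g : S → ℝ≥0∞} (h : f + mulVec Q g ≤ g) : potential Q f ≤ g := by
  have partialSum_le (N : ℕ) : ∑ t ∈ Finset.range N, (mulVec Q ^ t) f ≤ g := by
    induction N with
    | zero => simp
    | succ N ih =>
      rw [Finset.sum_range_succ', pow_zero, Module.End.one_apply, add_comm]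
      simp only [pow_succ', Module.End.mul_apply, ← map_sum]
      exact (add_le_add_right (mulVec_mono le_rfl ih) f).trans h
  intro x
  rw [potential, ENNReal.tsum_eq_iSup_nat]
  exact iSup_le fun N => by simpa only [Finset.sum_apply] using partialSum_le N x

end Potential

section HittingTime

/-- The matrix `P` with the transitions into `A` removed. -/
noncomputable def taboo (P : S → S → ℝ≥0∞) (A : Set S) (x : S) : S → ℝ≥0∞ := Aᶜ.indicator (P x)

/-- The expected first time `t ≥ 1` at which a chain with transition matrix `P` is in `A`, as the
sum over `t` of the probabilities to avoid `A` at the times `1, …, t`. -/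
noncomputable def meanHittingTime (P : S → S → ℝ≥0∞) (A : Set S) : S → ℝ≥0∞ :=
  potential (taboo P A) 1

/-- From every state, the chain enters `A` in finite expected time. -/
def HitsInFiniteMean (P : S → S → ℝ≥0∞) (A : Set S) : Prop := ∀ z, meanHittingTime P A z ≠ ⊤

/-- The rows of `P` are probability distributions. -/
def IsStochastic (P : S → S → ℝ≥0∞) : Prop := ∀ x, ∑' y, P x y = 1

variable {P : S → S → ℝ≥0∞} {A B : Set S}

lemma taboo_le : taboo P A ≤ P := fun x => Set.indicator_le_self _ (P x)

lemma taboo_anti (h : A ⊆ B) : taboo P B ≤ taboo P A := fun _ =>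
  Set.indicator_le_indicator_of_subset (Set.compl_subset_compl.mpr h) fun _ => zero_le

lemma mulVec_taboo (f : S → ℝ≥0∞) : mulVec (taboo P A) f = mulVec P (Aᶜ.indicator f) := by
  ext x
  refine tsum_congr fun y => ?_
  by_cases hy : y ∈ A <;> simp [taboo, hy]

lemma meanHittingTime_eq (P : S → S → ℝ≥0∞) (A : Set S) :
    meanHittingTime P A = 1 + mulVec (taboo P A) (meanHittingTime P A) :=
  potential_eq _ _

lemma HitsInFiniteMean.of_superharmonic {W : S → ℝ≥0∞} (hW : ∀ z, W z ≠ ⊤)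
    (h : 1 + mulVec (taboo P A) W ≤ W) : HitsInFiniteMean P A :=
  fun z => ne_top_of_le_ne_top (hW z) (potential_le h z)

lemma HitsInFiniteMean.mono (h : HitsInFiniteMean P A) (hAB : A ⊆ B) : HitsInFiniteMean P B :=
  .of_superharmonic h <| (add_le_add_right (mulVec_mono (taboo_anti hAB) le_rfl) _).trans
    (meanHittingTime_eq P A).ge

/-- Foster's criterion: `f - C` is a lower bound for the drift of `V` towards `0`, so that this
drift is at least `1` off the set `{f ≤ C + 1}`. -/
lemma hitsInFiniteMean_of_drift {V f : S → ℝ≥0∞} {C : ℝ≥0∞} (hV : ∀ z, V z ≠ ⊤) (hC : C ≠ ⊤)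
    (h : ∀ z, mulVec P V z + f z ≤ V z + C) : HitsInFiniteMean P {z | f z ≤ C + 1} := by
  set A := {z | f z ≤ C + 1}
  set W := V + A.indicator fun _ => C + 1
  refine .of_superharmonic (W := W) (fun z => ?_) fun z => ?_
  · by_cases hz : z ∈ A <;> simp [W, hz, hV z, hC]
  have htaboo : mulVec (taboo P A) W z ≤ mulVec P V z := by
    rw [mulVec_taboo]
    refine mulVec_mono le_rfl (fun y => ?_) z
    by_cases hy : y ∈ A <;> simp [W, hy]
  refine (add_le_add_right htaboo _).trans ?_
  by_cases hz : z ∈ A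
  · calc 1 + mulVec P V z ≤ 1 + (V z + C) := add_le_add_right (le_self_add.trans (h z)) _
      _ = W z := by simp only [W, Pi.add_apply, Set.indicator_of_mem hz]; ring
  · refine (ENNReal.add_le_add_iff_right hC).mp ?_
    calc 1 + mulVec P V z + C = mulVec P V z + (C + 1) := by ring
      _ ≤ mulVec P V z + f z := add_le_add_right (not_le.mp hz).le _
      _ ≤ W z + C := by simpa [W, hz] using h z

lemma mulVec_taboo_one_le (hP : IsStochastic P) (A : Set S) (x : S) :
    mulVec (taboo P A) 1 x ≤ 1 := by
  simpa [mulVec_one, hP x] using mulVec_mono (taboo_le (P := P)) (le_refl 1) x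

lemma add_mulVec_taboo_one_le (hP : IsStochastic P) {x y : S} (hy : y ∈ A) :
    P x y + mulVec (taboo P A) 1 x ≤ 1 := by
  classical
  rw [mulVec_one, ← hP x, ← tsum_ite_eq y fun w => P x w, ← ENNReal.tsum_add]
  refine ENNReal.tsum_le_tsum fun w => ?_
  by_cases hw : w = y
  · simp [hw, hy, taboo]
  · simpa [hw] using taboo_le x w

/-- Let `m` be the mean hitting time of `insert z A`. Since a visit to `z` moves to `y` with
probability `P z y`, the constant `D = m z / P z y` bounds the remaining time after a visit to
`z`. -/
lemma HitsInFiniteMean.insert_of_pos (hP : IsStochastic P) {z y : S}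
    (h : HitsInFiniteMean P (insert z A)) (hzy : 0 < P z y) : HitsInFiniteMean P (insert y A) := by
  set m := meanHittingTime P (insert z A)
  have hm : ∀ w, m w ≠ ⊤ := h
  have hPzy : P z y ≠ ⊤ := ENNReal.ne_top_of_tsum_ne_top (by simp [hP z]) y
  obtain ⟨D, hD, hmz⟩ : ∃ D : ℝ≥0∞, D ≠ ⊤ ∧ m z = D * P z y :=
    ⟨m z / P z y, ENNReal.div_ne_top (hm z) hzy.ne', (ENNReal.div_mul_cancel hzy.ne' hPzy).symm⟩
  set W := ({z}ᶜ : Set S).indicator m + D • (1 : S → ℝ≥0∞)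
  have hle : mulVec (taboo P (insert y A)) W ≤
      mulVec (taboo P (insert z A)) m + D • mulVec (taboo P (insert y A)) 1 := by
    simp only [W, map_add, map_smul]
    refine add_le_add_left ?_ _
    rw [mulVec_taboo, mulVec_taboo]
    refine mulVec_mono le_rfl fun w => ?_
    by_cases hwz : w = z <;> by_cases hwA : w ∈ A <;> by_cases hwy : w = y <;>
      simp [hwz, hwA, hwy]
  refine .of_superharmonic (W := W) (fun w => ?_) fun w => ?_
  · by_cases hw : w = z <;> simp [W, hw, hD, hm w]
  calc (1 + mulVec (taboo P (insert y A)) W) w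
      ≤ 1 + (mulVec (taboo P (insert z A)) m w + D * mulVec (taboo P (insert y A)) 1 w) :=
        add_le_add_right (hle w) _
    _ = m w + D * mulVec (taboo P (insert y A)) 1 w := by
        rw [← add_assoc]; exact congrArg (· + _) (congrFun (meanHittingTime_eq P _) w).symm
    _ ≤ W w := by
        by_cases hw : w = z
        · subst hw
          simpa [W, hmz, ← mul_add] using
            mul_le_mul_right (add_mulVec_taboo_one_le hP (Set.mem_insert y A)) D
        · simpa [W, hw] using
            add_le_add_right (mul_le_mul_right (mulVec_taboo_one_le hP _ w) D) (m w)

lemma HitsInFiniteMean.insert_of_reflTransGen (hP : IsStochastic P) {z y : S}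
    (h : HitsInFiniteMean P (insert z A)) (hzy : ReflTransGen (fun u v => 0 < P u v) z y) :
    HitsInFiniteMean P (insert y A) := by
  induction hzy with
  | refl => exact h
  | tail _ huv ih => exact ih.insert_of_pos hP huv

lemma HitsInFiniteMean.singleton_of_finite (hP : IsStochastic P) {o : S} (hA : A.Finite)
    (h : HitsInFiniteMean P A) (hAo : ∀ z ∈ A, ReflTransGen (fun u v => 0 < P u v) z o) :
    HitsInFiniteMean P {o} := by
  replace h : HitsInFiniteMean P (insert o A) := h.mono (Set.subset_insert o A)
  induction A, hA using Set.Finite.induction_on with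
  | empty => simpa using h
  | @insert z A _ _ ih =>
    refine ih (fun w hw => hAo w (Set.mem_insert_of_mem z hw)) ?_
    rw [Set.insert_comm] at h
    simpa using h.insert_of_reflTransGen hP (hAo z (Set.mem_insert z A))

end HittingTime

section Stationary

variable {P : S → S → ℝ≥0∞} {o : S}

lemma tsum_mulVec_swap (hP : IsStochastic P) (p : S → ℝ≥0∞) :
    ∑' y, mulVec (swap P) p y = ∑' x, p x := by
  have h := tsum_mul_mulVec P p 1
  simp only [mulVec_one, hP _, Pi.one_apply, mul_one] at h
  exact h.symm

open Classical in
lemma mulVec_swap_eq_taboo_add (P : S → S → ℝ≥0∞) (o : S) (p : S → ℝ≥0∞) :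
    mulVec (swap P) p = mulVec (swap (taboo P {o})) p + mulVec (swap P) p o • Pi.single o 1 := by
  ext y
  by_cases hy : y = o
  · subst hy; simp [mulVec_apply, swap, taboo]
  · simp [mulVec_apply, swap, taboo, hy]

open Classical in
/-- The expected number of visits to each state during an excursion of the chain from `o`, with
the start of the excursion counted and its end not. -/
noncomputable def excursionMeasure (P : S → S → ℝ≥0∞) (o : S) : S → ℝ≥0∞ :=
  potential (swap (taboo P {o})) (Pi.single o 1)

lemma tsum_excursionMeasure (P : S → S → ℝ≥0∞) (o : S) :
    ∑' y, excursionMeasure P o y = meanHittingTime P {o} o := by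
  classical
  have h := tsum_mul_potential (taboo P {o}) (Pi.single o 1) 1
  simp only [Pi.one_apply, mul_one] at h
  rw [excursionMeasure, ← h, tsum_eq_single o fun x hx => by simp [hx], Pi.single_eq_same, one_mul,
    meanHittingTime]

lemma excursionMeasure_self (P : S → S → ℝ≥0∞) (o : S) : excursionMeasure P o o = 1 := by
  classical
  rw [excursionMeasure, potential_eq]
  simp [mulVec_apply, swap, taboo]

/-- The mass `c` that flows into `o` replaces the unit mass in which the excursion starts, and
`c = 1` because `P` preserves the total mass. -/
lemma mulVec_swap_excursionMeasure (hP : IsStochastic P) (h : meanHittingTime P {o} o ≠ ⊤) :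
    mulVec (swap P) (excursionMeasure P o) = excursionMeasure P o := by
  classical
  set ν := excursionMeasure P o
  set c := mulVec (swap P) ν o
  have hbalance : mulVec (swap P) ν + Pi.single o 1 = ν + c • Pi.single o 1 := by
    rw [mulVec_swap_eq_taboo_add P o, add_right_comm, add_comm (mulVec _ _)]
    exact congrArg (· + c • Pi.single o 1) (potential_eq _ _).symm
  have hc : c = 1 := by
    have hmass := congrArg (fun f : S → ℝ≥0∞ => ∑' y, f y) hbalance
    simp only [Pi.add_apply, ENNReal.tsum_add, tsum_mulVec_swap hP, Pi.smul_apply, smul_eq_mul,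
      ENNReal.tsum_mul_left, tsum_pi_single, mul_one] at hmass
    exact ((ENNReal.add_right_inj (tsum_excursionMeasure P o ▸ h)).mp hmass).symm
  ext y
  have hy := congrFun hbalance y
  rw [hc, one_smul] at hy
  refine (ENNReal.add_left_inj ?_).mp hy
  by_cases hyo : y = o <;> simp [hyo]

lemma smul_excursionMeasure_le {p : S → ℝ≥0∞} (hp : mulVec (swap P) p = p) :
    p o • excursionMeasure P o ≤ p := by
  classical
  rw [excursionMeasure, ← potential_smul]
  refine potential_le (le_of_eq ?_)
  conv_rhs => rw [← hp, mulVec_swap_eq_taboo_add P o, hp]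
  exact add_comm _ _

lemma eq_zero_of_mulVec_swap_eq {q : S → ℝ≥0∞} (hq : mulVec (swap P) q = q) {x y : S}
    (hxy : ReflTransGen (fun u v => 0 < P u v) x y) (hy : q y = 0) : q x = 0 := by
  induction hxy using ReflTransGen.head_induction_on with
  | refl => exact hy
  | @head u v huv _ ih =>
    have hterm : P u v * q u = 0 := ENNReal.tsum_eq_zero.mp ((congrFun hq v).trans ih) u
    exact (mul_eq_zero.mp hterm).resolve_left huv.ne'

/-- The difference of both sides is an invariant measure that vanishes at `o`. -/
lemma eq_smul_excursionMeasure (hP : IsStochastic P) (h : meanHittingTime P {o} o ≠ ⊤)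
    (hreach : ∀ x, ReflTransGen (fun u v => 0 < P u v) x o) {p : S → ℝ≥0∞} (hpt : ∀ x, p x ≠ ⊤)
    (hp : mulVec (swap P) p = p) : p = p o • excursionMeasure P o := by
  set r := p o • excursionMeasure P o
  have hr : mulVec (swap P) r = r := by
    rw [map_smul, mulVec_swap_excursionMeasure hP h]
  have hrp : r ≤ p := smul_excursionMeasure_le hp
  have hsub : p - r + r = p := tsub_add_cancel_of_le hrp
  have hinv : mulVec (swap P) (p - r) = p - r := by
    have hpr := map_add (mulVec (swap P)) (p - r) r
    rw [hsub, hp, hr] at hpr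
    ext x
    exact (ENNReal.add_left_inj (ne_top_of_le_ne_top (hpt x) (hrp x))).mp
      (congrFun (hpr.symm.trans hsub.symm) x)
  have hzero : p - r = 0 := funext fun x =>
    eq_zero_of_mulVec_swap_eq hinv (hreach x) (by simp [r, excursionMeasure_self])
  rw [← hsub, hzero, zero_add]

theorem existsUnique_stationary (hP : IsStochastic P) (h : meanHittingTime P {o} o ≠ ⊤)
    (hreach : ∀ x, ReflTransGen (fun u v => 0 < P u v) x o) :
    ∃! p : PMF S, ∀ y, ∑' x, p x * P x y = p y := by
  have stationary_iff (p : S → ℝ≥0∞) :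
      (∀ y, ∑' x, p x * P x y = p y) ↔ mulVec (swap P) p = p := by
    simp only [funext_iff, mulVec_apply, swap, mul_comm]
  simp only [stationary_iff]
  set ν := excursionMeasure P o
  have hν : ∑' y, ν y ≠ ⊤ := tsum_excursionMeasure P o ▸ h
  have hν0 : ∑' y, ν y ≠ 0 := fun h0 =>
    one_ne_zero ((excursionMeasure_self P o).symm.trans (ENNReal.tsum_eq_zero.mp h0 o))
  have hnorm : ⇑(PMF.normalize ν hν0 hν) = (∑' y, ν y)⁻¹ • ν := by
    ext y; simp [mul_comm]
  refine ⟨PMF.normalize ν hν0 hν, ?_, fun p hp => DFunLike.coe_injective ?_⟩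
  · beta_reduce
    rw [hnorm, map_smul, mulVec_swap_excursionMeasure hP h]
  · have hpν : ⇑p = p o • ν := eq_smul_excursionMeasure hP h hreach p.apply_ne_top hp
    have hpo : p o * ∑' y, ν y = 1 := by
      rw [← ENNReal.tsum_mul_left, ← p.tsum_coe]
      exact tsum_congr fun y => (congrFun hpν y).symm
    rw [hnorm, ← ENNReal.eq_inv_of_mul_eq_one_left hpo]
    exact hpν

end Stationary

section RandomMapping

open MeasureTheory ProbabilityTheory

variable {R : Type*} (F : S → R → S) (A : Set S)

/-- The chain that starts in `x` and moves from `y` to `F y (ω t)` at time `t`. -/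
def orbit (x : S) (ω : ℕ → R) : ℕ → S
  | 0 => x
  | t + 1 => F (orbit x ω t) (ω t)

lemma orbit_succ' (x : S) (ω : ℕ → R) (t : ℕ) :
    orbit F x ω (t + 1) = orbit F (F x (ω 0)) (fun s => ω (s + 1)) t := by
  induction t with
  | zero => rfl
  | succ t ih => rw [orbit, ih, orbit]

/-- The first time `t ≥ 1` at which the sequence `u` is in `A`. -/
noncomputable def hittingTime (u : ℕ → S) : ℕ∞ := ⨅ (t : ℕ) (_ : 1 ≤ t ∧ u t ∈ A), (t : ℕ∞)

variable {A} in
lemma lt_hittingTime_iff {u : ℕ → S} {t : ℕ} :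
    (t : ℕ∞) < hittingTime A u ↔ ∀ s < t, u (s + 1) ∉ A := by
  rw [← ENat.add_one_le_iff (ENat.natCast_ne_top t), hittingTime, le_iInf₂_iff]
  norm_cast
  refine ⟨fun h s hs hsA => ?_, fun h s ⟨hs, hsA⟩ => ?_⟩
  · exact hs.not_ge (Nat.le_of_succ_le_succ (h (s + 1) ⟨by omega, hsA⟩))
  · obtain ⟨s, rfl⟩ := Nat.exists_eq_add_of_le' hs
    exact Nat.succ_le_succ (not_lt.mp fun hst => h s hst hsA)

lemma succ_lt_hittingTime_orbit {F : S → R → S} {A : Set S} {x : S} {ω : ℕ → R} {t : ℕ} :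
    ((t + 1 : ℕ) : ℕ∞) < hittingTime A (orbit F x ω) ↔
      F x (ω 0) ∉ A ∧ (t : ℕ∞) < hittingTime A (orbit F (F x (ω 0)) fun s => ω (s + 1)) := by
  simp only [lt_hittingTime_iff, orbit_succ' F x, Nat.forall_lt_succ_left]
  rfl

lemma toENNReal_eq_tsum_lt (T : ℕ∞) :
    (T : ℝ≥0∞) = ∑' t : ℕ, if (t : ℕ∞) < T then 1 else 0 := by
  induction T using ENat.recTopCoe with
  | top => simp
  | coe k =>
    rw [tsum_eq_sum (s := Finset.range k) (by simp)]
    rw [Finset.sum_congr rfl (g := fun _ => 1) fun t ht => by simpa using ht]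
    simp

lemma measurePreserving_head_tail {Ω : ℕ → Type*} [∀ t, MeasurableSpace (Ω t)]
    (μ : ∀ t, Measure (Ω t)) [∀ t, IsProbabilityMeasure (μ t)] :
    MeasurePreserving (fun ω : ∀ t, Ω t => (ω 0, fun t => ω (t + 1))) (Measure.infinitePi μ)
      ((μ 0).prod (Measure.infinitePi fun t => μ (t + 1))) := by
  have hhead : Measurable fun ω : ∀ t, Ω t => ω 0 := by fun_prop
  have htail : Measurable fun (ω : ∀ t, Ω t) (t : ℕ) => ω (t + 1) := by fun_prop
  refine ⟨hhead.prodMk htail, ?_⟩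
  have hindep : IndepFun (fun ω : ∀ t, Ω t => ω 0) (fun ω t => ω (t + 1))
      (Measure.infinitePi μ) := by
    refine IndepFun.indepFun_process hhead (fun t => measurable_pi_apply (t + 1)) fun I => ?_
    have hcoord : iIndepFun (fun t (ω : ∀ t, Ω t) => ω t) (Measure.infinitePi μ) :=
      iIndepFun_infinitePi (X := fun _ => id) fun _ => measurable_id
    have hfin := hcoord.indepFun_finset {0} (I.map (addRightEmbedding 1)) (by simp)
      measurable_pi_apply
    have hφ : Measurable fun u : ∀ i : ({0} : Finset ℕ), Ω i => u ⟨0, by simp⟩ :=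
      measurable_pi_apply _
    have hψ : Measurable fun (u : ∀ i : I.map (addRightEmbedding 1), Ω i) (i : I) =>
        u ⟨i + 1, by simp⟩ := by fun_prop
    exact hfin.comp hφ hψ
  rw [(indepFun_iff_map_prod_eq_prod_map_map hhead.aemeasurable htail.aemeasurable).mp hindep,
    Measure.infinitePi_map_eval, Measure.map_infinitePi_infinitePi_of_inj (add_left_injective 1)]

variable [MeasurableSpace R] (μ : Measure R)

/-- The transition probabilities of the chain whose steps are the random mappings `F · r`, where
`r` is drawn from `μ`. -/
noncomputable def transition (x y : S) : ℝ≥0∞ := μ {r | F x r = y}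

variable {F} [Countable S] [MeasurableSpace S] [DiscreteMeasurableSpace S]
  (hF : ∀ x, Measurable (F x))
include hF

lemma mulVec_transition (f : S → ℝ≥0∞) (x : S) :
    mulVec (transition F μ) f x = ∫⁻ r, f (F x r) ∂μ := by
  rw [← lintegral_map (f := f) (.of_discrete) (hF x), lintegral_countable']
  refine tsum_congr fun y => ?_
  rw [Measure.map_apply (hF x) (.of_discrete), mul_comm]
  rfl

lemma measurable_orbit (t : ℕ) : Measurable fun q : S × (ℕ → R) => orbit F q.1 q.2 t := by
  induction t with
  | zero => exact measurable_fst
  | succ t ih =>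
    have huncurry : Measurable (uncurry F) := measurable_from_prod_countable_right hF
    exact huncurry.comp (ih.prodMk ((measurable_pi_apply t).comp measurable_snd))

lemma measurableSet_lt_hittingTime (t : ℕ) :
    MeasurableSet {q : S × (ℕ → R) | (t : ℕ∞) < hittingTime A (orbit F q.1 q.2)} := by
  simp only [lt_hittingTime_iff, Set.ofPred_forall]
  exact .iInter fun s => .iInter fun _ =>
    measurable_orbit hF (s + 1) (MeasurableSet.of_discrete (s := Aᶜ))

lemma measurableSet_lt_hittingTime_orbit (x : S) (t : ℕ) :
    MeasurableSet {ω | (t : ℕ∞) < hittingTime A (orbit F x ω)} :=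
  measurable_prodMk_left (measurableSet_lt_hittingTime A hF t)

variable [IsProbabilityMeasure μ]

lemma isStochastic_transition : IsStochastic (transition F μ) := fun x => by
  simpa [mulVec_one] using mulVec_transition μ hF 1 x

lemma infinitePi_lt_hittingTime (x : S) (t : ℕ) :
    Measure.infinitePi (fun _ : ℕ => μ) {ω | (t : ℕ∞) < hittingTime A (orbit F x ω)} =
      (mulVec (taboo (transition F μ) A) ^ t) 1 x := by
  induction t generalizing x with
  | zero => simp only [lt_hittingTime_iff]; simp
  | succ t ih =>
    set E := {q : R × (ℕ → R) | F x q.1 ∉ A ∧ (t : ℕ∞) < hittingTime A (orbit F (F x q.1) q.2)}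
    have hE : MeasurableSet E :=
      ((hF x).comp measurable_fst (MeasurableSet.of_discrete (s := Aᶜ))).inter
        (((hF x).comp measurable_fst).prodMk measurable_snd (measurableSet_lt_hittingTime A hF t))
    have hpre : {ω | ((t + 1 : ℕ) : ℕ∞) < hittingTime A (orbit F x ω)} =
        (fun ω : ℕ → R => (ω 0, fun s => ω (s + 1))) ⁻¹' E :=
      Set.ext fun ω => succ_lt_hittingTime_orbit
    rw [hpre, (measurePreserving_head_tail fun _ => μ).measure_preimage hE.nullMeasurableSet,
      Measure.prod_apply hE, pow_succ', Module.End.mul_apply, mulVec_taboo,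
      mulVec_transition μ hF]
    refine lintegral_congr fun r => ?_
    by_cases hr : F x r ∈ A <;> simp [E, hr, ih]

lemma lintegral_hittingTime (x : S) :
    ∫⁻ ω, hittingTime A (orbit F x ω) ∂Measure.infinitePi (fun _ : ℕ => μ) =
      meanHittingTime (transition F μ) A x := by
  simp only [toENNReal_eq_tsum_lt]
  rw [lintegral_tsum fun t => (Measurable.ite (measurableSet_lt_hittingTime_orbit A hF x t)
    measurable_const measurable_const).aemeasurable]
  refine tsum_congr fun t => ?_
  rw [← infinitePi_lt_hittingTime A μ hF x t,
    ← lintegral_indicator_one (measurableSet_lt_hittingTime_orbit A hF x t)]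
  exact lintegral_congr fun ω => by simp [Set.indicator_apply]

lemma ae_hittingTime_lt_top {x : S} (h : meanHittingTime (transition F μ) A x ≠ ⊤) :
    ∀ᵐ ω ∂Measure.infinitePi (fun _ : ℕ => μ), hittingTime A (orbit F x ω) < ⊤ := by
  have hmeas : Measurable fun ω => (hittingTime A (orbit F x ω) : ℝ≥0∞) := by
    simp only [toENNReal_eq_tsum_lt]
    exact .tsum fun t => Measurable.ite (measurableSet_lt_hittingTime_orbit A hF x t)
      measurable_const measurable_const
  filter_upwards [ae_lt_top hmeas (lintegral_hittingTime A μ hF x ▸ h)] with ω hω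
  simpa using hω

end RandomMapping

end DiscreteChain

namespace TwoChoice

open MeasureTheory ProbabilityTheory DiscreteChain
open scoped ENNReal

variable {n : ℕ}

section Loads

lemma exists_perm_toLoadVector (z : Fin n → ℕ) :
    ∃ σ : Equiv.Perm (Fin n), (toLoadVector z).1 = z ∘ σ :=
  ⟨Fin.revPerm.trans (Tuple.sort z), rfl⟩

lemma toLoadVector_comp_perm (z : Fin n → ℕ) (σ : Equiv.Perm (Fin n)) :
    toLoadVector (z ∘ σ) = toLoadVector z :=
  Subtype.ext <| funext fun i => congrFun (Tuple.comp_perm_comp_sort_eq_comp_sort) i.rev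

lemma toLoadVector_coe (x : LoadVector n) : toLoadVector x.1 = x := by
  have hmono : Monotone (x.1 ∘ Fin.revPerm) := fun _ _ h => x.2 (Fin.rev_le_rev.mpr h)
  refine Subtype.ext (funext fun i => ?_)
  have := congrFun (Tuple.comp_sort_eq_comp_iff_monotone.mpr hmono) (Fin.rev i)
  simpa [toLoadVector] using this.symm

lemma sum_toLoadVector {M : Type*} [AddCommMonoid M] (φ : ℕ → M) (z : Fin n → ℕ) :
    ∑ i, φ ((toLoadVector z).1 i) = ∑ i, φ (z i) := by
  obtain ⟨σ, hσ⟩ := exists_perm_toLoadVector z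
  simpa only [hσ, Function.comp_apply] using Equiv.sum_comp σ fun i => φ (z i)

/-- The number of balls in the system. -/
def totalLoad (x : LoadVector n) : ℕ := ∑ i, x.1 i

/-- The quadratic potential of a load vector, the Lyapunov function of the process. -/
def sqLoad (x : LoadVector n) : ℕ := ∑ i, x.1 i ^ 2

lemma totalLoad_eq_zero_iff {x : LoadVector n} : totalLoad x = 0 ↔ x = emptySystem n := by
  simp [totalLoad, emptySystem, Subtype.ext_iff, funext_iff]

lemma finite_totalLoad_le (k : ℕ) : {x : LoadVector n | totalLoad x ≤ k}.Finite := by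
  refine Set.Finite.subset ((Set.finite_Iic (fun _ : Fin n => k)).preimage
    Subtype.val_injective.injOn) fun x hx i => ?_
  exact (Finset.single_le_sum (fun _ _ => Nat.zero_le _) (Finset.mem_univ i)).trans hx

lemma sum_afterDeletion_sq_le (x : LoadVector n) :
    ∑ i, afterDeletion x i ^ 2 + 2 * ∑ i, afterDeletion x i ≤ sqLoad x := by
  rw [Finset.mul_sum, ← Finset.sum_add_distrib]
  refine Finset.sum_le_sum fun i _ => ?_
  obtain h | ⟨k, h⟩ : x.1 i = 0 ∨ ∃ k, x.1 i = k + 1 := by cases x.1 i <;> simp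
  · simp [afterDeletion, h]
  · simp only [afterDeletion, h, Nat.add_sub_cancel]
    nlinarith

lemma totalLoad_le_sum_afterDeletion (x : LoadVector n) :
    totalLoad x ≤ ∑ i, afterDeletion x i + n := by
  calc totalLoad x ≤ ∑ i, (afterDeletion x i + 1) := Finset.sum_le_sum fun i _ => le_tsub_add
    _ = ∑ i, afterDeletion x i + n := by simp [Finset.sum_add_distrib]

lemma totalLoad_toLoadVector_afterDeletion_lt {x : LoadVector n} (hx : x ≠ emptySystem n) :
    totalLoad (toLoadVector (afterDeletion x)) < totalLoad x := by
  obtain ⟨i, -, hi⟩ := Finset.exists_ne_zero_of_sum_ne_zero (totalLoad_eq_zero_iff.not.mpr hx)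
  rw [totalLoad, sum_toLoadVector fun k => k]
  exact Finset.sum_lt_sum (fun j _ => Nat.sub_le _ _)
    ⟨i, Finset.mem_univ i, Nat.sub_lt (Nat.pos_of_ne_zero hi) one_pos⟩

lemma two_mul_leastLoaded_le (y : Fin n → ℕ) (i j : Fin n) :
    2 * y (leastLoaded y i j) ≤ y i + y j := by
  unfold leastLoaded
  split_ifs with hij hji
  · omega
  · omega
  · rcases max_choice i j with h | h <;> rw [h] <;> omega

/-- In the expansion of `(yᵢ + Bᵢ)²`, where `Bᵢ` balls fall into bin `i`, each ball contributes
twice the load of its bin to the mixed terms, hence at most the loads of its two choices. -/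
lemma sqLoad_step_le (x : LoadVector n) (r : Round n) :
    sqLoad (step x r) ≤ ∑ i, afterDeletion x i ^ 2 +
      ∑ g, (if (r g).1 = true then
        afterDeletion x (r g).2.1 + afterDeletion x (r g).2.2 else 0) + n ^ 3 := by
  set y := afterDeletion x
  set B : Fin n → ℕ := fun i => (Finset.univ.filter fun g : Fin n =>
      (r g).1 = true ∧ leastLoaded y (r g).2.1 (r g).2.2 = i).card with hB
  have hB_sq : ∑ i, B i ^ 2 ≤ n ^ 3 := by
    calc ∑ i, B i ^ 2 ≤ ∑ _i : Fin n, n ^ 2 := by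
          refine Finset.sum_le_sum fun i _ => Nat.pow_le_pow_left ?_ 2
          exact (Finset.card_filter_le _ _).trans (by simp)
      _ = n ^ 3 := by simp; ring
  have hmixed : ∑ i, 2 * y i * B i ≤
      ∑ g, (if (r g).1 = true then y (r g).2.1 + y (r g).2.2 else 0) := by
    simp only [hB, Finset.card_filter, Finset.mul_sum]
    rw [Finset.sum_comm]
    refine Finset.sum_le_sum fun g _ => ?_
    by_cases hg : (r g).1 = true
    · simpa [hg] using two_mul_leastLoaded_le y (r g).2.1 (r g).2.2
    · simp [hg]
  calc sqLoad (step x r) = ∑ i, (y i + B i) ^ 2 := sum_toLoadVector (· ^ 2) _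
    _ = ∑ i, y i ^ 2 + ∑ i, 2 * y i * B i + ∑ i, B i ^ 2 := by
        rw [← Finset.sum_add_distrib, ← Finset.sum_add_distrib]
        exact Finset.sum_congr rfl fun i _ => by ring
    _ ≤ _ := by gcongr

end Loads

section Law

lemma measurable_step (x : LoadVector n) : Measurable (step x) := .of_discrete

variable [NeZero n] (lam : unitInterval)

instance : IsProbabilityMeasure (generatorLaw n lam) := by unfold generatorLaw; infer_instance

instance : IsProbabilityMeasure (roundLaw n lam) := by unfold roundLaw; infer_instance

lemma transProb_eq_transition :
    transProb (n := n) lam = transition step (roundLaw n lam) := rfl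

lemma isStochastic_transProb : IsStochastic (transProb (n := n) lam) :=
  isStochastic_transition (roundLaw n lam) measurable_step

variable {lam}

lemma toNNReal_symm_pos (h1 : lam < 1) :
    0 < unitInterval.toNNReal (unitInterval.symm lam) := by
  rw [← NNReal.coe_pos, unitInterval.coe_toNNReal, unitInterval.coe_symm_eq]
  exact sub_pos.mpr h1

lemma bernoulliMeasure_false_pos (h1 : lam < 1) :
    0 < bernoulliMeasure true false lam {false} := by
  simpa [bernoulliMeasure_def] using toNNReal_symm_pos h1

lemma bernoulliMeasure_true_pos (h0 : 0 < lam) :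
    0 < bernoulliMeasure true false lam {true} := by
  have hpos : 0 < unitInterval.toNNReal lam := by
    rwa [← NNReal.coe_pos, unitInterval.coe_toNNReal]
  simpa [bernoulliMeasure_def] using hpos

lemma generatorLaw_singleton_pos {c : Bool × Fin n × Fin n}
    (hc : 0 < bernoulliMeasure true false lam {c.1}) : 0 < generatorLaw n lam {c} := by
  have huniform (i : Fin n) : (PMF.uniformOfFintype (Fin n)).toMeasure {i} ≠ 0 := by
    rw [PMF.toMeasure_apply_singleton _ _ (measurableSet_singleton i)]
    simp
  obtain ⟨b, i, j⟩ := c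
  rw [generatorLaw, ← Set.singleton_prod_singleton, Measure.prod_prod,
    ← Set.singleton_prod_singleton, Measure.prod_prod]
  exact ENNReal.mul_pos hc.ne' (mul_ne_zero (huniform i) (huniform j))

lemma transProb_step_pos (x : LoadVector n) {r : Round n}
    (hr : ∀ g, 0 < bernoulliMeasure true false lam {(r g).1}) :
    0 < transProb lam x (step x r) := by
  have hround : 0 < roundLaw n lam {r} := by
    rw [roundLaw, Measure.pi_singleton]
    exact CanonicallyOrderedAdd.prod_pos.mpr fun g _ => generatorLaw_singleton_pos (hr g)
  exact hround.trans_le (measure_mono (by simp))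

lemma reachable_emptySystem (h1 : lam < 1) (x : LoadVector n) :
    Reachable lam x (emptySystem n) := by
  induction hk : totalLoad x using Nat.strong_induction_on generalizing x with
  | _ k ih =>
    by_cases hx : x = emptySystem n
    · exact hx ▸ .refl
    · have hstep : step x (fun _ => (false, 0, 0)) = toLoadVector (afterDeletion x) := by
        simp [step]
      have hpos := transProb_step_pos x (r := fun _ => (false, 0, 0))
        fun _ => bernoulliMeasure_false_pos h1
      exact .head (hstep ▸ hpos)
        (ih _ (hk ▸ totalLoad_toLoadVector_afterDeletion_lt hx) _ rfl)

end Law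

section Drift

lemma lintegral_uniformOfFintype {α : Type*} [Fintype α] [Nonempty α] [MeasurableSpace α]
    [MeasurableSingletonClass α] (f : α → ℝ≥0∞) :
    ∫⁻ a, f a ∂(PMF.uniformOfFintype α).toMeasure = (∑ a, f a) / Fintype.card α := by
  rw [lintegral_fintype, ENNReal.div_eq_inv_mul, Finset.mul_sum]
  refine Finset.sum_congr rfl fun a _ => ?_
  rw [PMF.toMeasure_apply_singleton _ _ (measurableSet_singleton a),
    PMF.uniformOfFintype_apply, mul_comm]

variable [NeZero n] (lam : unitInterval)

lemma lintegral_generatorLaw (f : Fin n → ℝ≥0∞) :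
    ∫⁻ c, (if c.1 = true then f c.2.1 + f c.2.2 else 0) ∂generatorLaw n lam =
      unitInterval.toNNReal lam * (2 * ((∑ i, f i) / n)) := by
  have hpair : ∫⁻ c : Fin n × Fin n, f c.1 + f c.2 ∂((PMF.uniformOfFintype (Fin n)).toMeasure.prod
      (PMF.uniformOfFintype (Fin n)).toMeasure) = 2 * ((∑ i, f i) / n) := by
    rw [lintegral_prod _ (measurable_of_countable _).aemeasurable]
    simp only [lintegral_add_left (measurable_of_countable _), lintegral_uniformOfFintype,
      Fintype.card_fin, lintegral_const, measure_univ, mul_one]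
    ring
  rw [generatorLaw, lintegral_prod _ (measurable_of_countable _).aemeasurable,
    bernoulliMeasure_def, lintegral_add_measure, lintegral_smul_measure,
    lintegral_smul_measure, lintegral_dirac, lintegral_dirac]
  simp [hpair, ENNReal.smul_def]

lemma lintegral_roundLaw_sum (f : Fin n → ℝ≥0∞) :
    ∫⁻ r, ∑ g, (if (r g).1 = true then f (r g).2.1 + f (r g).2.2 else 0) ∂roundLaw n lam =
      unitInterval.toNNReal lam * (2 * ∑ i, f i) := by
  have hgenerator (g : Fin n) : ∫⁻ r : Round n,
      (if (r g).1 = true then f (r g).2.1 + f (r g).2.2 else 0) ∂roundLaw n lam =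
      unitInterval.toNNReal lam * (2 * ((∑ i, f i) / n)) := by
    rw [← lintegral_generatorLaw]
    exact (measurePreserving_eval (fun _ : Fin n => generatorLaw n lam) g).lintegral_comp
      (f := fun c => if c.1 = true then f c.2.1 + f c.2.2 else 0) (measurable_of_countable _)
  have hn : (n : ℝ≥0∞) ≠ 0 := by exact_mod_cast NeZero.ne n
  rw [lintegral_finsetSum _ fun _ _ => measurable_of_countable _]
  simp only [hgenerator, Finset.sum_const, Finset.card_univ, Fintype.card_fin, nsmul_eq_mul]
  rw [mul_left_comm, mul_left_comm (n : ℝ≥0∞),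
    ENNReal.mul_div_cancel hn (ENNReal.natCast_ne_top n)]

lemma mulVec_transProb_sqLoad_le (x : LoadVector n) :
    mulVec (transProb lam) (fun z => (sqLoad z : ℝ≥0∞)) x ≤
      ∑ i, (afterDeletion x i : ℝ≥0∞) ^ 2 +
        unitInterval.toNNReal lam * (2 * ∑ i, (afterDeletion x i : ℝ≥0∞)) + n ^ 3 := by
  rw [transProb_eq_transition, mulVec_transition _ measurable_step]
  calc ∫⁻ r, (sqLoad (step x r) : ℝ≥0∞) ∂roundLaw n lam
      ≤ ∫⁻ r, (∑ i, (afterDeletion x i : ℝ≥0∞) ^ 2 + ∑ g, (if (r g).1 = true then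
          (afterDeletion x (r g).2.1 : ℝ≥0∞) + afterDeletion x (r g).2.2 else 0) + n ^ 3)
          ∂roundLaw n lam :=
        lintegral_mono fun r => by
          simpa using (Nat.cast_le (α := ℝ≥0∞)).mpr (sqLoad_step_le x r)
    _ = _ := by
        rw [lintegral_add_left (measurable_of_countable _),
          lintegral_add_left (measurable_of_countable _),
          lintegral_roundLaw_sum lam fun i => (afterDeletion x i : ℝ≥0∞)]
        simp

lemma mulVec_transProb_sqLoad_add_le (x : LoadVector n) :
    mulVec (transProb lam) (fun z => (sqLoad z : ℝ≥0∞)) x +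
        2 * unitInterval.toNNReal (unitInterval.symm lam) * totalLoad x ≤
      sqLoad x + (2 * n + n ^ 3) := by
  set y := afterDeletion x
  set a : ℝ≥0∞ := ENNReal.ofNNReal <| unitInterval.toNNReal lam
  set b : ℝ≥0∞ := ENNReal.ofNNReal <| unitInterval.toNNReal (unitInterval.symm lam)
  have hab : a + b = 1 := by
    rw [← ENNReal.coe_add, unitInterval.toNNReal_add_toNNReal_symm, ENNReal.coe_one]
  have hb : b ≤ 1 := hab ▸ le_add_self
  have hsq : ∑ i, (y i : ℝ≥0∞) ^ 2 + 2 * ∑ i, (y i : ℝ≥0∞) ≤ sqLoad x :=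
    mod_cast sum_afterDeletion_sq_le x
  have htotal : (totalLoad x : ℝ≥0∞) ≤ ∑ i, (y i : ℝ≥0∞) + n :=
    mod_cast totalLoad_le_sum_afterDeletion x
  calc mulVec (transProb lam) (fun z => (sqLoad z : ℝ≥0∞)) x + 2 * b * totalLoad x
      ≤ (∑ i, (y i : ℝ≥0∞) ^ 2 + a * (2 * ∑ i, (y i : ℝ≥0∞)) + n ^ 3) +
        2 * b * (∑ i, (y i : ℝ≥0∞) + n) := by
        gcongr
        exact mulVec_transProb_sqLoad_le lam x
    _ = (∑ i, (y i : ℝ≥0∞) ^ 2 + (a + b) * (2 * ∑ i, (y i : ℝ≥0∞))) + (2 * b * n + n ^ 3) := by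
        ring
    _ ≤ sqLoad x + (2 * 1 * n + n ^ 3) := by
        rw [hab, one_mul]
        gcongr
    _ = sqLoad x + (2 * n + n ^ 3) := by rw [mul_one]

lemma hitsInFiniteMean_emptySystem {lam : unitInterval} (h1 : lam < 1) :
    HitsInFiniteMean (transProb lam) {emptySystem n} := by
  set b : ℝ≥0∞ := ENNReal.ofNNReal <| unitInterval.toNNReal (unitInterval.symm lam)
  have hb : b ≠ 0 := ENNReal.coe_ne_zero.mpr (toNNReal_symm_pos h1).ne'
  have hC : (2 * n + n ^ 3 : ℝ≥0∞) ≠ ⊤ := mod_cast ENNReal.natCast_ne_top (2 * n + n ^ 3)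
  have hhit := hitsInFiniteMean_of_drift (fun z => ENNReal.natCast_ne_top (sqLoad z)) hC
    (mulVec_transProb_sqLoad_add_le (n := n) lam)
  have hfinite : {z : LoadVector n | 2 * b * totalLoad z ≤ 2 * n + n ^ 3 + 1}.Finite := by
    obtain ⟨M, hM⟩ := ENNReal.exists_nat_gt (ENNReal.div_ne_top
      (ENNReal.add_ne_top.mpr ⟨hC, ENNReal.one_ne_top⟩) (mul_ne_zero two_ne_zero hb))
    refine (finite_totalLoad_le M).subset fun z hz => ?_
    rw [Set.mem_ofPred_eq, mul_comm] at hz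
    have hz' := ENNReal.le_div_iff_mul_le (.inl (mul_ne_zero two_ne_zero hb))
      (.inl (ENNReal.mul_ne_top (by simp) ENNReal.coe_ne_top)) |>.mpr hz
    exact_mod_cast (hz'.trans_lt hM).le
  exact hhit.singleton_of_finite (isStochastic_transProb lam) hfinite fun z _ =>
    reachable_emptySystem h1 z

end Drift

section Recurrence

lemma process_eq_orbit (x : LoadVector n) (ω : ℕ → Round n) : process x ω = orbit step x ω := by
  ext1 t
  induction t with
  | zero => rfl
  | succ t ih => rw [process, orbit, ih]

lemma returnTime_eq_hittingTime (x : LoadVector n) (ω : ℕ → Round n) :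
    returnTime x ω = hittingTime {x} (orbit step x ω) := by
  rw [← process_eq_orbit]
  rfl

lemma positiveRecurrent_of_meanHittingTime_ne_top [NeZero n] {lam : unitInterval}
    {x : LoadVector n} (h : meanHittingTime (transProb lam) {x} x ≠ ⊤) :
    PositiveRecurrent lam x := by
  simp only [PositiveRecurrent, returnTime_eq_hittingTime, choicesLaw]
  refine ⟨?_, ?_⟩
  · exact (measure_congr (Filter.eventuallyEq_univ.mpr
      (ae_hittingTime_lt_top {x} (roundLaw n lam) measurable_step h))).trans measure_univ
  · rw [lintegral_hittingTime {x} (roundLaw n lam) measurable_step]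
    exact h.lt_top

end Recurrence

section Irreducibility

lemma exists_card_fiber_eq {α β : Type*} [Fintype α] [DecidableEq α] [Fintype β] (d : α → ℕ)
    (hd : ∑ a, d a ≤ Fintype.card β) :
    ∃ f : β → Option α, ∀ a, (Finset.univ.filter fun b => f b = some a).card = d a := by
  obtain ⟨e⟩ : Nonempty ((Σ a, Fin (d a)) ↪ β) :=
    Function.Embedding.nonempty_of_card_le (by simpa using hd)
  have he := e.injective.isPartialInv
  refine ⟨fun b => (Function.partialInv e b).map Sigma.fst, fun a => ?_⟩
  have hfiber : (Finset.univ.filter fun b => (Function.partialInv e b).map Sigma.fst = some a) =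
      Finset.univ.map ((Function.Embedding.sigmaMk a).trans e) := by
    ext b
    simp [he _ _]
  rw [hfiber, Finset.card_map, Finset.card_univ, Fintype.card_fin]

lemma leastLoaded_self (y : Fin n → ℕ) (i : Fin n) : leastLoaded y i i = i := by
  simp [leastLoaded]

variable [NeZero n]

/-- The round in which generator `g` generates a ball with both choices equal to `i` if
`f g = some i`, and no ball if `f g = none`. -/
def directedRound (f : Fin n → Option (Fin n)) : Round n :=
  fun g => ((f g).isSome, (f g).getD 0, (f g).getD 0)

lemma step_directedRound (x : LoadVector n) (f : Fin n → Option (Fin n)) :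
    step x (directedRound f) = toLoadVector fun i =>
      afterDeletion x i + (Finset.univ.filter fun g => f g = some i).card := by
  have hball (g i : Fin n) : (f g).isSome = true ∧ (f g).getD 0 = i ↔ f g = some i := by
    cases f g <;> simp
  simp only [step, directedRound, leastLoaded_self, hball]

variable {lam : unitInterval}

lemma transProb_toLoadVector_pos (h0 : 0 < lam) (h1 : lam < 1) {z w : Fin n → ℕ}
    (hle : ∀ i, z i - 1 ≤ w i) (hsum : ∑ i, (w i - (z i - 1)) ≤ n) :
    0 < transProb lam (toLoadVector z) (toLoadVector w) := by
  obtain ⟨σ, hσ⟩ := exists_perm_toLoadVector z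
  obtain ⟨f, hf⟩ := exists_card_fiber_eq (β := Fin n) (fun i => w (σ i) - (z (σ i) - 1)) <| by
    simpa [Equiv.sum_comp σ fun i => w i - (z i - 1)] using hsum
  have hstep : step (toLoadVector z) (directedRound f) = toLoadVector w := by
    rw [step_directedRound, ← toLoadVector_comp_perm w σ]
    congr 1 with i
    rw [hf, afterDeletion, hσ]
    exact Nat.add_sub_of_le (hle (σ i))
  rw [← hstep]
  refine transProb_step_pos _ fun g => ?_
  cases hg : (directedRound f g).1
  · exact bernoulliMeasure_false_pos h1
  · exact bernoulliMeasure_true_pos h0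

lemma reachable_toLoadVector_single (h0 : 0 < lam) (h1 : lam < 1) (hn : 2 ≤ n) (k : ℕ) :
    Reachable lam (emptySystem n) (toLoadVector (Pi.single 0 k)) := by
  induction k with
  | zero => rw [Pi.single_zero]; exact .refl
  | succ k ih =>
    refine ih.tail (transProb_toLoadVector_pos h0 h1 (fun i => ?_) ?_)
    · simp only [Pi.single_apply]
      split_ifs <;> omega
    · rw [Finset.sum_eq_single 0 (fun i _ hi => by simp [hi]) (by simp)]
      simp only [Pi.single_eq_same]
      omega

/-- Apart from bins `0` and `i`, each non-empty bin gets one ball to make up for its deletion. Bin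
`i` gets at most two balls and bin `0` none, so the `n` generators suffice. -/
lemma transProb_add_single_pos (h0 : 0 < lam) (h1 : lam < 1) (v : Fin n → ℕ) {i : Fin n}
    (hi : i ≠ 0) :
    0 < transProb lam (toLoadVector (v + Pi.single 0 1)) (toLoadVector (v + Pi.single i 1)) := by
  refine transProb_toLoadVector_pos h0 h1 (fun j => ?_) ?_
  · simp only [Pi.add_apply, Pi.single_apply]
    split_ifs <;> omega
  · have hballs (j : Fin n) : (v + Pi.single i 1 : Fin n → ℕ) j -
        ((v + Pi.single 0 1 : Fin n → ℕ) j - 1) + (Pi.single 0 1 : Fin n → ℕ) j ≤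
        1 + (Pi.single i 1 : Fin n → ℕ) j := by
      simp only [Pi.add_apply, Pi.single_apply]
      grind
    have hsum := Finset.sum_le_sum fun j (_ : j ∈ Finset.univ) => hballs j
    simpa [Finset.sum_add_distrib] using hsum

/-- The balls of `s` are first piled up in bin `0` and then moved one by one. -/
lemma reachable_toLoadVector_count (h0 : 0 < lam) (h1 : lam < 1) (hn : 2 ≤ n)
    (s : Multiset (Fin n)) (k : ℕ) :
    Reachable lam (emptySystem n) (toLoadVector ((fun i => s.count i) + Pi.single 0 k)) := by
  induction s using Multiset.induction generalizing k with
  | empty => simpa [← Pi.zero_def] using reachable_toLoadVector_single h0 h1 hn k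
  | cons i s ih =>
    have hcons : (fun j => (i ::ₘ s).count j) = (fun j => s.count j) + Pi.single i 1 := by
      ext j
      simp [Multiset.count_cons, Pi.single_apply]
    have hpred := ih (k + 1)
    rw [Pi.single_add, ← add_assoc] at hpred
    rw [hcons, add_right_comm]
    rcases eq_or_ne i 0 with rfl | hi
    · exact hpred
    · exact hpred.tail (transProb_add_single_pos h0 h1 _ hi)

lemma reachable_of_pos (h0 : 0 < lam) (h1 : lam < 1) (hn : 2 ≤ n) (x y : LoadVector n) :
    Reachable lam x y := by
  have hy := reachable_toLoadVector_count h0 h1 hn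
    (Finsupp.toMultiset (Finsupp.equivFunOnFinite.symm y.1)) 0
  simp only [Finsupp.count_toMultiset, Finsupp.equivFunOnFinite_symm_apply_apply, Pi.single_zero,
    add_zero, toLoadVector_coe] at hy
  exact (reachable_emptySystem h1 x).trans hy

end Irreducibility

end TwoChoice

open TwoChoice in
theorem mainTheorem4_general (n : ℕ) [NeZero n] (lam : unitInterval) (hlam : lam < 1) :
    (0 < lam → 2 ≤ n → ∀ x y : LoadVector n, Reachable lam x y) ∧
    (∀ x : LoadVector n, Reachable lam (emptySystem n) x → PositiveRecurrent lam x) ∧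
    (∃! p : PMF (LoadVector n), Stationary lam p) := by
  have hP := isStochastic_transProb (n := n) lam
  have hempty := hitsInFiniteMean_emptySystem (n := n) hlam
  refine ⟨fun h0 hn x y => reachable_of_pos h0 hlam hn x y, fun x hx => ?_, ?_⟩
  · have hreturn : DiscreteChain.HitsInFiniteMean (transProb lam) {x} :=
      hempty.singleton_of_finite hP (Set.finite_singleton _) fun z hz => hz ▸ hx
    exact positiveRecurrent_of_meanHittingTime_ne_top (hreturn x)
  · exact DiscreteChain.existsUnique_stationary hP (hempty _) (reachable_emptySystem hlam)

theorem mainTheorem4 (n : ℕ) [NeZero n] (lam : unitInterval)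
    (hlam : (lam : ℝ) ∈ Set.Ico (1 / 4 : ℝ) 1) :
    (2 ≤ n → ∀ x y : TwoChoice.LoadVector n, TwoChoice.Reachable lam x y) ∧
    (∀ x : TwoChoice.LoadVector n, TwoChoice.Reachable lam (TwoChoice.emptySystem n) x →
      TwoChoice.PositiveRecurrent lam x) ∧
    (∃! p : PMF (TwoChoice.LoadVector n), TwoChoice.Stationary lam p) := by
  have hpos : (0 : ℝ) < lam := (by norm_num : (0 : ℝ) < 1 / 4).trans_le hlam.1
  exact (mainTheorem4_general n lam hlam.2).imp_left fun h => h hpos
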